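/- Let $d\ge 1$, let $c(x,y)=\tfrac12\|x-y\|^2$ on $\mathbb R^d\times\mathbb R^d$, and let $\mu_0,\mu_1$ be Borel probability measures on $\mathbb R^d$ with finite second moments. Let $(\varphi,\psi)$ be a pair of Kantorovich potentials, that is, functions $\varphi,\psi:\mathbb R^d\to[-\infty,\infty)$ with $\varphi\in L^1(\mu_0)$, $\psi\in L^1(\mu_1)$ which are $c$-transforms of each other, $\varphi(x)=\inf_y\big(c(x,y)-\psi(y)\big)$ and $\psi(y)=\inf_x\big(c(x,y)-\varphi(x)\big)$ for all $x,y\in\mathbb R^d$, and which maximize $\int\varphi\,d\mu_0+\int\psi\,d\mu_1$ among all integrable pairs with $\varphi(x)+\psi(y)\le c(x,y)$ for all $x,y$ (for instance real-valued continuous ones). Let $E(x,y)=c(x,y)-\varphi(x)-\psi(y)\in[0,\infty]$ be the duality gap, and let $\gamma_0$ be any optimal transport plan from $\mu_0$ to $\mu_1$ for the cost $c$. For a probability measure $\mu$ on $\mathbb R^k$ with Lebesgue density $\rho$, let $H(\mu)=\int\rho\ln\rho\in[-\infty,\infty]$, read as $+\infty$ if $\int\rho\,(\ln\rho)^+=\infty$,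 and let $N_k(\mu)=\frac1{2\pi e}e^{-\frac2kH(\mu)}\in[0,\infty]$. For a probability measure $\gamma$ on $\mathbb R^{2d}=\mathbb R^d\times\mathbb R^d$, let $\hat\mu$ be the law of $\frac1{\sqrt2}(X+Y)$ and $\sigma_\gamma(X+Y)=\big(\mathbb E\|X+Y-\mathbb E(X+Y)\|^2\big)^{1/2}$ (equal to $\infty$ if $X+Y$ is not square integrable) when $(X,Y)$ has law $\gamma$. Let $W_2$ be the 2-Wasserstein distance on $\mathbb R^{2d}$ for the Euclidean norm, with values in $[0,\infty]$, and let $C_d=-\frac d2\ln\frac{4\pi e}{d}$. Then for every absolutely continuous probability measure $\gamma$ on $\mathbb R^{2d}$, $$H(\gamma)\ \ge\ -\frac d2\ln\Big(\int E\,d\gamma\Big)+H(\hat\mu)+C_d,\qquad H(\gamma)\ \ge\ -\frac d2\ln W_2^2(\gamma,\gamma_0)+H(\hat\mu)+C_d,$$ where the right-hand side is read as $-\infty$ if $\int E\,d\gamma=\infty$, respectively $W_2(\gamma,\gamma_0)=\infty$. Moreover $$N_{2d}(\gamma)\ \le\ \frac{\sigma_\gamma(X+Y)}{d}\sqrt{\int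 E\,d\gamma},\qquad N_{2d}(\gamma)\ \le\ \frac{\sigma_\gamma(X+Y)}{d}\,W_2(\gamma,\gamma_0).$$ -/

import Mathlib

open MeasureTheory
open scoped ENNReal

noncomputable section

namespace QuadraticOT

/-- The space `ℝ^d` with its Euclidean norm. -/
abbrev Rd (d : ℕ) : Type := EuclideanSpace ℝ (Fin d)

/-- Probability measures on `ℝ^d` with finite second moment. -/
def IsP2 {d : ℕ} (μ : Measure (Rd d)) : Prop :=
  IsProbabilityMeasure μ ∧ MemLp (fun x : Rd d => x) 2 μ

/-- The quadratic cost `c(x, y) = ‖x - y‖² / 2`. -/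
def quadCost {d : ℕ} (x y : Rd d) : ℝ := ‖x - y‖ ^ 2 / 2

/-- `π` is a transport plan from `μ` to `ν`: it has marginals `μ` and `ν`. -/
def IsPlan {X Y : Type*} [MeasurableSpace X] [MeasurableSpace Y]
    (μ : Measure X) (ν : Measure Y) (π : Measure (X × Y)) : Prop :=
  π.fst = μ ∧ π.snd = ν

/-- `γ₀` is an optimal transport plan from `μ₀` to `μ₁` for the quadratic cost. -/
def IsOptimalPlan {d : ℕ} (μ₀ μ₁ : Measure (Rd d)) (γ₀ : Measure (Rd d × Rd d)) : Prop :=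
  IsPlan μ₀ μ₁ γ₀ ∧ ∀ π : Measure (Rd d × Rd d), IsPlan μ₀ μ₁ π →
    ∫⁻ p, ENNReal.ofReal (quadCost p.1 p.2) ∂γ₀ ≤ ∫⁻ p, ENNReal.ofReal (quadCost p.1 p.2) ∂π

/-- The squared Euclidean distance on `ℝ^{2d} = ℝ^d × ℝ^d` (the distance that Lean puts on a
product type is the maximum distance, hence the explicit formula). -/
def sqDist2d {d : ℕ} (z w : Rd d × Rd d) : ℝ := ‖z.1 - w.1‖ ^ 2 + ‖z.2 - w.2‖ ^ 2

/-- The squared 2-Wasserstein distance between measures on `ℝ^{2d}`, with values in `[0, ∞]`. -/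
def W2sq {d : ℕ} (γ γ' : Measure (Rd d × Rd d)) : ℝ≥0∞ :=
  ⨅ (π : Measure ((Rd d × Rd d) × (Rd d × Rd d))) (_ : IsPlan γ γ' π),
    ∫⁻ q, ENNReal.ofReal (sqDist2d q.1 q.2) ∂π

/-- The 2-Wasserstein distance between measures on `ℝ^{2d}`, with values in `[0, ∞]`. -/
def W2 {d : ℕ} (γ γ' : Measure (Rd d × Rd d)) : ℝ≥0∞ := W2sq γ γ' ^ (1 / 2 : ℝ)

/-- Kantorovich potentials for the quadratic cost: integrable functions with values in `[-∞, ∞)`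
that are `c`-transforms of each other and maximize `∫ φ dμ₀ + ∫ ψ dμ₁` under the constraint
`φ(x) + ψ(y) ≤ c(x, y)`. The value `-∞` is allowed on null sets because it cannot be avoided for a
mutual `c`-transform pair on the whole space, e.g. from a Gaussian to a measure of compact support;
real-valued continuous potentials are a special case. -/
structure IsKantorovichPair {d : ℕ} (μ₀ μ₁ : Measure (Rd d)) (φ ψ : Rd d → EReal) : Prop where
  left_ne_top : ∀ x, φ x ≠ ⊤
  right_ne_top : ∀ y, ψ y ≠ ⊤
  left_ne_bot : ∀ᵐ x ∂μ₀, φ x ≠ ⊥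
  right_ne_bot : ∀ᵐ y ∂μ₁, ψ y ≠ ⊥
  left_integrable : Integrable (fun x => (φ x).toReal) μ₀
  right_integrable : Integrable (fun y => (ψ y).toReal) μ₁
  left_eq : ∀ x, φ x = ⨅ y, ((quadCost x y : ℝ) : EReal) - ψ y
  right_eq : ∀ y, ψ y = ⨅ x, ((quadCost x y : ℝ) : EReal) - φ x
  maximal : ∀ φ' ψ' : Rd d → ℝ, Integrable φ' μ₀ → Integrable ψ' μ₁ →
    (∀ x y, φ' x + ψ' y ≤ quadCost x y) →
    ∫ x, φ' x ∂μ₀ + ∫ y, ψ' y ∂μ₁ ≤ ∫ x, (φ x).toReal ∂μ₀ + ∫ y, (ψ y).toReal ∂μ₁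

/-- The duality gap `E(x, y) = c(x, y) - (φ(x) + ψ(y))`, with values in `[0, ∞]` for a pair of
Kantorovich potentials. -/
def dualityGap {d : ℕ} (φ ψ : Rd d → EReal) (x y : Rd d) : EReal :=
  ((quadCost x y : ℝ) : EReal) - (φ x + ψ y)

/-- `∫ E dγ` in `[0, ∞]`. -/
def gapIntegral {d : ℕ} (φ ψ : Rd d → EReal) (γ : Measure (Rd d × Rd d)) : ℝ≥0∞ :=
  ∫⁻ p, (dualityGap φ ψ p.1 p.2).toENNReal ∂γ

/-- `∫ (ln dμ/dν)⁺ dμ`. -/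
def entropyPos {X : Type*} [MeasurableSpace X] (μ ν : Measure X) : ℝ≥0∞ :=
  ∫⁻ x, ENNReal.ofReal (Real.log (μ.rnDeriv ν x).toReal) ∂μ

/-- `∫ (ln dμ/dν)⁻ dμ`. -/
def entropyNeg {X : Type*} [MeasurableSpace X] (μ ν : Measure X) : ℝ≥0∞ :=
  ∫⁻ x, ENNReal.ofReal (-Real.log (μ.rnDeriv ν x).toReal) ∂μ

open Classical in
/-- The relative entropy `H(μ | ν) = ∫ ln (dμ/dν) dμ` in `[-∞, ∞]`, which is `+∞` if `μ` is not
absolutely continuous. It is `+∞` as soon as the positive part has infinite integral (this is the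
usual value if the negative part is integrable, and a convention otherwise). -/
def relEntropy {X : Type*} [MeasurableSpace X] (μ ν : Measure X) : EReal :=
  if μ ≪ ν ∧ entropyPos μ ν ≠ ⊤ then (entropyPos μ ν : EReal) - (entropyNeg μ ν : EReal) else ⊤

/-- The differential entropy `H(μ)`, relative to Lebesgue measure. -/
def diffEntropy {X : Type*} [MeasureSpace X] (μ : Measure X) : EReal :=
  relEntropy μ volume

/-- The entropy power `N_k(μ) = exp(-(2/k) H(μ)) / (2πe)` in `[0, ∞]`. -/
def entropyPower {X : Type*} [MeasureSpace X] (k : ℕ) (μ : Measure X) : ℝ≥0∞ :=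
  ENNReal.ofReal (1 / (2 * Real.pi * Real.exp 1)) *
    EReal.exp (((-(2 / (k : ℝ)) : ℝ) : EReal) * diffEntropy μ)

/-- Minty's coordinates `(u, v) = (x + y, x - y) / √2`. -/
def minty {d : ℕ} (p : Rd d × Rd d) : Rd d × Rd d :=
  ((Real.sqrt 2)⁻¹ • (p.1 + p.2), (Real.sqrt 2)⁻¹ • (p.1 - p.2))

/-- The first marginal of the push-forward of `γ` by Minty's change of coordinates. -/
def mintyMarginal {d : ℕ} (γ : Measure (Rd d × Rd d)) : Measure (Rd d) :=
  (γ.map minty).fst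

/-- The standard deviation of `X + Y` for `(X, Y)` of law `γ`, in `[0, ∞]`; it is `∞` if `X + Y` is
not square integrable. -/
def sigmaSum {d : ℕ} (γ : Measure (Rd d × Rd d)) : ℝ≥0∞ :=
  (∫⁻ p, ‖(p.1 + p.2) - ∫ q, (q.1 + q.2) ∂γ‖ₑ ^ 2 ∂γ) ^ (1 / 2 : ℝ)

/-- The constant `C_d = -(d/2) ln (4πe/d)`. -/
def constC (d : ℕ) : ℝ := -((d : ℝ) / 2) * Real.log (4 * Real.pi * Real.exp 1 / d)

end QuadraticOT

end

noncomputable section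

namespace QuadraticOT

-- Quadratic `c`-transforms and their contact set

variable {d : ℕ}

-- In Minty's coordinates `u = (x + y)/√2`, `v = (x - y)/√2`, monotone sets are graphs of
-- 1-Lipschitz maps. Hence both `∫ E dγ` and `W₂²(γ, γ₀)` dominate `∫ ‖v - T u‖²/2 dγ` for suitable
-- 1-Lipschitz maps `T`.
--
-- For the gap, the graph of `T` consists of contact points `E = 0`: there is one on every
-- antidiagonal `x + y = a`, and comparing `(x, y)` with the one on its own antidiagonal gives the
-- bound pointwise (`exists_lipschitz_le_dualityGap`). For `W₂`, an exchange argument on `γ₀ ⊗ γ₀`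
-- shows that the support of `γ₀` is monotone, and Kirszbraun's theorem extends the resulting
-- partial map (`IsOptimalPlan.exists_lipschitz_le_W2sq`).
--
-- The rest is Gibbs' inequality `H(γ) ≥ ∫ log Q dγ` for a trial density `Q = f(u) g(v - T u)`. Its
-- mass is `∫ f · ∫ g`, since the shear by `T` preserves volume. Take `g` Gaussian with variance
-- fitted to the bound. With `f` the density of the first Minty marginal this gives the entropy
-- inequalities (`diffEntropy_ge_of_graph`); with `f` Gaussian, fitted to `σ(X + Y)`, the entropy
-- power inequalities (`entropyPower_le_of_graph`).

lemma norm_sq_eq_inner (x : Rd d) : ‖x‖ ^ 2 = inner ℝ x x :=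
  (real_inner_self_eq_norm_sq x).symm

lemma continuous_quadCost : Continuous fun p : Rd d × Rd d => quadCost p.1 p.2 := by
  unfold quadCost; fun_prop

lemma quadCost_nonneg (x y : Rd d) : 0 ≤ quadCost x y := by
  unfold quadCost; positivity

/-- `φ` is the `c`-transform of `ψ`, for the quadratic cost. -/
def IsCTransform (φ ψ : Rd d → EReal) : Prop :=
  ∀ x, φ x = ⨅ y, ((quadCost x y : ℝ) : EReal) - ψ y

lemma IsCTransform.le {φ ψ : Rd d → EReal} (h : IsCTransform φ ψ) (x y : Rd d) :
    φ x ≤ (quadCost x y : EReal) - ψ y := by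
  rw [h x]; exact iInf_le _ y

lemma IsCTransform.real_le {φ ψ : Rd d → EReal} (h : IsCTransform φ ψ) {x y : Rd d} {r s : ℝ}
    (hr : φ x = r) (hs : ψ y = s) : r ≤ quadCost x y - s := by
  have := h.le x y
  rw [hr, hs] at this
  exact_mod_cast this

lemma IsCTransform.upperSemicontinuous {φ ψ : Rd d → EReal} (h : IsCTransform φ ψ)
    (hψ : ∀ y, ψ y ≠ ⊤) : UpperSemicontinuous φ := by
  rw [show φ = fun x => ⨅ y, ((quadCost x y : ℝ) : EReal) - ψ y from funext h]
  refine upperSemicontinuous_iInf fun y => Continuous.upperSemicontinuous ?_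
  rcases eq_or_ne (ψ y) ⊥ with hb | hb
  · simp only [hb, EReal.coe_sub_bot]; exact continuous_const
  · lift ψ y to ℝ using ⟨hψ y, hb⟩ with s
    have : Continuous fun x : Rd d => ((quadCost x y - s : ℝ) : EReal) :=
      continuous_coe_real_ereal.comp
        ((continuous_quadCost.comp (continuous_id.prodMk continuous_const)).sub continuous_const)
    simpa using this

/-- A `c`-transform is semiconcave. -/
lemma IsCTransform.semiconcave {φ ψ : Rd d → EReal} (h : IsCTransform φ ψ) (hψ : ∀ y, ψ y ≠ ⊤)
    {x z : Rd d} {r s : ℝ} (hr : φ x = r) (hs : φ z = s) {t : ℝ} (ht0 : 0 ≤ t) (ht1 : t ≤ 1) :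
    (((1 - t) * r + t * s - t * (1 - t) / 2 * ‖z - x‖ ^ 2 : ℝ) : EReal) ≤ φ (x + t • (z - x)) := by
  rw [h (x + t • (z - x))]
  refine le_iInf fun y => ?_
  rcases eq_or_ne (ψ y) ⊥ with hb | hb
  · simp [hb]
  · obtain ⟨q, hq⟩ : ∃ q : ℝ, ψ y = q := ⟨(ψ y).toReal, (EReal.coe_toReal (hψ y) hb).symm⟩
    have h1 := h.real_le hr hq
    have h2 := h.real_le hs hq
    rw [hq, ← EReal.coe_sub, EReal.coe_le_coe_iff]
    -- The modulus is exact for each `quadCost · y`, and an infimum over `y` preserves the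
    -- inequality.
    have key : (1 - t) * quadCost x y + t * quadCost z y - t * (1 - t) / 2 * ‖z - x‖ ^ 2
        = quadCost (x + t • (z - x)) y := by
      unfold quadCost
      simp only [norm_sq_eq_inner, inner_sub_left, inner_sub_right, inner_add_left, inner_add_right,
        inner_smul_left, inner_smul_right, RCLike.conj_to_real]
      rw [real_inner_comm x z, real_inner_comm x y, real_inner_comm z y]
      ring
    nlinarith [mul_le_mul_of_nonneg_left h1 (sub_nonneg.2 ht1), mul_le_mul_of_nonneg_left h2 ht0]

/-- The function whose maximizers are the resolvent of the superdifferential attains its maximum. -/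
lemma IsCTransform.exists_maximizer {φ ψ : Rd d → EReal} (h : IsCTransform φ ψ)
    (hφ : ∀ x, φ x ≠ ⊤) (hψ : ∀ y, ψ y ≠ ⊤) (hφ' : ∃ x, φ x ≠ ⊥) (hψ' : ∃ y, ψ y ≠ ⊥) (a : Rd d) :
    ∃ (x : Rd d) (r : ℝ), φ x = r ∧ ∀ z, φ z ≤
      ((r + (‖z‖ ^ 2 - inner ℝ a z) - (‖x‖ ^ 2 - inner ℝ a x) : ℝ) : EReal) := by
  obtain ⟨x₀, hx₀⟩ := hφ'
  obtain ⟨y₀, hy₀⟩ := hψ'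
  obtain ⟨b, hb⟩ : ∃ q : ℝ, ψ y₀ = q := ⟨(ψ y₀).toReal, (EReal.coe_toReal (hψ y₀) hy₀).symm⟩
  obtain ⟨g, hg⟩ : ∃ q : ℝ, φ x₀ = q := ⟨(φ x₀).toReal, (EReal.coe_toReal (hφ x₀) hx₀).symm⟩
  -- With `φ = ‖·‖²/2 - f`, a maximizer of `G` is the proximal point of `f` at `a`, so formally `a -
  -- x ∈ ∂f(x)`.
  set G : Rd d → EReal := fun x => φ x + ((inner ℝ a x - ‖x‖ ^ 2 : ℝ) : EReal) with hG
  have hcont : Continuous fun x : Rd d => ((inner ℝ a x - ‖x‖ ^ 2 : ℝ) : EReal) :=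
    continuous_coe_real_ereal.comp (by fun_prop)
  have husc : UpperSemicontinuous G :=
    (h.upperSemicontinuous hψ).add' hcont.upperSemicontinuous fun x =>
      EReal.continuousAt_add (Or.inl (hφ x)) (Or.inr (EReal.coe_ne_top _))
  set g₀ : ℝ := g + (inner ℝ a x₀ - ‖x₀‖ ^ 2) with hg₀
  set C : ℝ := ‖y₀‖ ^ 2 / 2 - b with hC
  -- Testing with `y₀` gives `G z ≤ C + ⟪a - y₀, z⟫ - ‖z‖²/2`, which is at most `g₀` once `‖z‖ > R`;
  -- the summand `‖x₀‖` puts `x₀` in the ball.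
  set R : ℝ := 2 * ‖a - y₀‖ + 2 * |C - g₀| + 1 + ‖x₀‖ with hR
  have hx₀R : x₀ ∈ Metric.closedBall (0 : Rd d) R := by
    have := norm_nonneg (a - y₀)
    have := abs_nonneg (C - g₀)
    rw [mem_closedBall_zero_iff]; linarith
  obtain ⟨x, -, hx⟩ := (husc.upperSemicontinuousOn _).exists_isMaxOn ⟨x₀, hx₀R⟩
    (isCompact_closedBall _ _)
  have hGx₀ : G x₀ = g₀ := by simp only [hG, hg, hg₀, EReal.coe_add]
  have hmax : ∀ z, G z ≤ G x := fun z => by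
    by_cases hz : z ∈ Metric.closedBall (0 : Rd d) R
    · exact hx hz
    refine le_trans ?_ (hGx₀.symm.trans_le (hx hx₀R))
    rcases eq_or_ne (φ z) ⊥ with hzb | hzb
    · simp [hG, hzb]
    obtain ⟨f, hf⟩ : ∃ q : ℝ, φ z = q := ⟨(φ z).toReal, (EReal.coe_toReal (hφ z) hzb).symm⟩
    have h1 := h.real_le hf hb
    simp only [hG, hf]
    rw [← EReal.coe_add, EReal.coe_le_coe_iff]
    rw [mem_closedBall_zero_iff, not_le] at hz
    have h2 : quadCost z y₀ = ‖z‖ ^ 2 / 2 - inner ℝ y₀ z + ‖y₀‖ ^ 2 / 2 := by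
      unfold quadCost; rw [norm_sub_sq_real, real_inner_comm]; ring
    have h3 : inner ℝ (a - y₀) z ≤ ‖a - y₀‖ * ‖z‖ := real_inner_le_norm _ _
    rw [inner_sub_left] at h3
    have h4 := le_abs_self (C - g₀)
    have h5 := norm_nonneg (a - y₀)
    have h6 := abs_nonneg (C - g₀)
    have h7 := norm_nonneg x₀
    have h8 : |C - g₀| ≤ ‖z‖ * (‖z‖ / 2 - ‖a - y₀‖) := by
      calc |C - g₀| = 1 * |C - g₀| := (one_mul _).symm
        _ ≤ ‖z‖ * (‖z‖ / 2 - ‖a - y₀‖) := by gcongr <;> linarith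
    nlinarith
  have hxb : φ x ≠ ⊥ := fun hb => by
    have := hmax x₀
    rw [hGx₀] at this
    simp [hG, hb] at this
  obtain ⟨r, hr⟩ : ∃ q : ℝ, φ x = q := ⟨(φ x).toReal, (EReal.coe_toReal (hφ x) hxb).symm⟩
  refine ⟨x, r, hr, fun z => ?_⟩
  rcases eq_or_ne (φ z) ⊥ with hzb | hzb
  · simp [hzb]
  obtain ⟨f, hf⟩ : ∃ q : ℝ, φ z = q := ⟨(φ z).toReal, (EReal.coe_toReal (hφ z) hzb).symm⟩
  have := hmax z
  simp only [hG, hf, hr] at this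
  rw [← EReal.coe_add, ← EReal.coe_add, EReal.coe_le_coe_iff] at this
  rw [hf, EReal.coe_le_coe_iff]
  linarith

/-- The contact set of a pair of conjugate functions meets every antidiagonal. -/
lemma exists_contact {φ ψ : Rd d → EReal} (h : IsCTransform φ ψ)
    (h' : ∀ y, ψ y = ⨅ x, ((quadCost x y : ℝ) : EReal) - φ x)
    (hφ : ∀ x, φ x ≠ ⊤) (hψ : ∀ y, ψ y ≠ ⊤) (hφ' : ∃ x, φ x ≠ ⊥) (hψ' : ∃ y, ψ y ≠ ⊥) (a : Rd d) :
    ∃ (x y : Rd d) (r s : ℝ), x + y = a ∧ φ x = r ∧ ψ y = s ∧ r + s = quadCost x y := by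
  obtain ⟨x, r, hr, hmax⟩ := h.exists_maximizer hφ hψ hφ' hψ' a
  have hle : ((quadCost x (a - x) - r : ℝ) : EReal) ≤ ψ (a - x) := by
    rw [h']
    refine le_iInf fun z => ?_
    rcases eq_or_ne (φ z) ⊥ with hzb | hzb
    · simp [hzb]
    obtain ⟨f, hf⟩ : ∃ q : ℝ, φ z = q := ⟨(φ z).toReal, (EReal.coe_toReal (hφ z) hzb).symm⟩
    rw [hf, ← EReal.coe_sub, EReal.coe_le_coe_iff]
    -- Maximality alone leaves a quadratic error. Applied on the segment from `x` to `z` together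
    -- with semiconcavity, and divided by `t`, it leaves an error `t‖z - x‖²/2` that vanishes as `t
    -- → 0`.
    have hquot : ∀ t : ℝ, 0 < t → t ≤ 1 → f - r ≤
        quadCost z (a - x) - quadCost x (a - x) + t * (‖z - x‖ ^ 2 / 2) := fun t ht0 ht1 => by
      have h1 := (h.semiconcave hψ hr hf ht0.le ht1).trans (hmax _)
      rw [EReal.coe_le_coe_iff] at h1
      have key : (‖x + t • (z - x)‖ ^ 2 - inner ℝ a (x + t • (z - x))) - (‖x‖ ^ 2 - inner ℝ a x)
          + t * (1 - t) / 2 * ‖z - x‖ ^ 2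
          = t * (quadCost z (a - x) - quadCost x (a - x) + t * (‖z - x‖ ^ 2 / 2)) := by
        unfold quadCost
        simp only [norm_sq_eq_inner, inner_sub_left, inner_sub_right, inner_add_left,
          inner_add_right, inner_smul_left, inner_smul_right, RCLike.conj_to_real]
        rw [real_inner_comm x z, real_inner_comm a z, real_inner_comm a x]
        ring
      refine le_of_mul_le_mul_left ?_ ht0
      linarith
    have hlim : Filter.Tendsto (fun t : ℝ => quadCost z (a - x) - quadCost x (a - x)
        + t * (‖z - x‖ ^ 2 / 2)) (nhdsWithin 0 (Set.Ioi 0))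
        (nhds (quadCost z (a - x) - quadCost x (a - x) + 0 * (‖z - x‖ ^ 2 / 2))) :=
      (Continuous.tendsto (by fun_prop) 0).mono_left nhdsWithin_le_nhds
    have := ge_of_tendsto hlim (Filter.mem_of_superset
      (Ioc_mem_nhdsGT (zero_lt_one' ℝ)) fun t ht => hquot t ht.1 ht.2)
    linarith
  have hne : ψ (a - x) ≠ ⊥ := fun hb => EReal.coe_ne_bot _ (le_bot_iff.1 (hb ▸ hle))
  obtain ⟨s, hs⟩ : ∃ q : ℝ, ψ (a - x) = q :=
    ⟨(ψ (a - x)).toReal, (EReal.coe_toReal (hψ _) hne).symm⟩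
  refine ⟨x, a - x, r, s, by abel, hr, hs, ?_⟩
  rw [hs, EReal.coe_le_coe_iff] at hle
  have := h.real_le hr hs
  linarith

-- Minty's coordinates and the duality gap

lemma minty_fst (p : Rd d × Rd d) : (minty p).1 = (Real.sqrt 2)⁻¹ • (p.1 + p.2) := rfl

lemma minty_snd (p : Rd d × Rd d) : (minty p).2 = (Real.sqrt 2)⁻¹ • (p.1 - p.2) := rfl

lemma norm_inv_sqrt_two_smul_sq (x : Rd d) : ‖(Real.sqrt 2)⁻¹ • x‖ ^ 2 = ‖x‖ ^ 2 / 2 := by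
  rw [norm_smul, mul_pow, Real.norm_eq_abs, sq_abs, inv_pow, Real.sq_sqrt (by norm_num)]
  ring

lemma norm_minty_sub_fst_sq (p q : Rd d × Rd d) :
    ‖(minty p).1 - (minty q).1‖ ^ 2 = ‖(p.1 + p.2) - (q.1 + q.2)‖ ^ 2 / 2 := by
  rw [minty_fst, minty_fst, ← smul_sub, norm_inv_sqrt_two_smul_sq]

lemma norm_minty_sub_snd_sq (p q : Rd d × Rd d) :
    ‖(minty p).2 - (minty q).2‖ ^ 2 = ‖(p.1 - p.2) - (q.1 - q.2)‖ ^ 2 / 2 := by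
  rw [minty_snd, minty_snd, ← smul_sub, norm_inv_sqrt_two_smul_sq]

/-- Monotonicity in Minty's coordinates is the Lipschitz property with constant one. -/
lemma norm_minty_sub_le {p q : Rd d × Rd d} (h : 0 ≤ inner ℝ (p.1 - q.1) (p.2 - q.2)) :
    ‖(minty p).2 - (minty q).2‖ ≤ ‖(minty p).1 - (minty q).1‖ := by
  refine (sq_le_sq₀ (norm_nonneg _) (norm_nonneg _)).1 ?_
  rw [norm_minty_sub_fst_sq, norm_minty_sub_snd_sq,
    show p.1 + p.2 - (q.1 + q.2) = (p.1 - q.1) + (p.2 - q.2) by abel,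
    show p.1 - p.2 - (q.1 - q.2) = (p.1 - q.1) - (p.2 - q.2) by abel,
    norm_add_sq_real, norm_sub_sq_real]
  linarith

lemma quadCost_exchange (x y x' y' : Rd d) :
    quadCost x y' + quadCost x' y - quadCost x y - quadCost x' y' = inner ℝ (x - x') (y - y') := by
  unfold quadCost
  simp only [norm_sub_sq_real, inner_sub_left, inner_sub_right]
  ring

/-- The duality gap dominates half of the squared distance to a Lipschitz graph in Minty's
coordinates. -/
theorem exists_lipschitz_le_dualityGap {φ ψ : Rd d → EReal} (h : IsCTransform φ ψ)
    (h' : ∀ y, ψ y = ⨅ x, ((quadCost x y : ℝ) : EReal) - φ x)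
    (hφ : ∀ x, φ x ≠ ⊤) (hψ : ∀ y, ψ y ≠ ⊤) (hφ' : ∃ x, φ x ≠ ⊥) (hψ' : ∃ y, ψ y ≠ ⊥) :
    ∃ T : Rd d → Rd d, LipschitzWith 1 T ∧ ∀ p : Rd d × Rd d,
      ENNReal.ofReal (‖(minty p).2 - T (minty p).1‖ ^ 2 / 2) ≤
        (dualityGap φ ψ p.1 p.2).toENNReal := by
  -- The factor `√2` makes `u` the first Minty coordinate of the chosen contact point.
  choose X Y r s hsum hr hs hrs using fun u : Rd d =>
    exists_contact h h' hφ hψ hφ' hψ' (Real.sqrt 2 • u)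
  have h2 : (Real.sqrt 2)⁻¹ * Real.sqrt 2 = 1 := inv_mul_cancel₀ (by positivity)
  have hmX : ∀ u, (minty (X u, Y u)).1 = u := fun u => by
    rw [minty_fst, hsum, smul_smul, h2, one_smul]
  refine ⟨fun u => (minty (X u, Y u)).2, ?_, fun p => ?_⟩
  · refine LipschitzWith.of_dist_le_mul fun u w => ?_
    have hmono : 0 ≤ inner ℝ (X u - X w) (Y u - Y w) := by
      rw [← quadCost_exchange]
      have h1 := h.real_le (hr u) (hs w)
      have h2 := h.real_le (hr w) (hs u)
      linarith [hrs u, hrs w]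
    have := norm_minty_sub_le (p := (X u, Y u)) (q := (X w, Y w)) hmono
    rw [hmX, hmX] at this
    simpa [dist_eq_norm] using this
  · obtain ⟨x, y⟩ := p
    set u := (minty (x, y)).1 with hu
    rcases eq_or_ne (φ x) ⊥ with hx | hx
    · simp [dualityGap, hx]
    rcases eq_or_ne (ψ y) ⊥ with hy | hy
    · simp [dualityGap, hy]
    obtain ⟨f, hf⟩ : ∃ q : ℝ, φ x = q := ⟨(φ x).toReal, (EReal.coe_toReal (hφ x) hx).symm⟩
    obtain ⟨g, hg⟩ : ∃ q : ℝ, ψ y = q := ⟨(ψ y).toReal, (EReal.coe_toReal (hψ y) hy).symm⟩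
    have h3 := h.real_le hf (hs u)
    have h4 := h.real_le (hr u) hg
    have hadd : X u + Y u = x + y := by
      rw [hsum, hu, minty_fst, smul_smul, mul_comm, h2, one_smul]
    -- On a common antidiagonal the exchange term `-⟪x - X u, y - Y u⟫`, a lower bound for the gap,
    -- equals `‖x - X u‖²`.
    have hy : y - Y u = -(x - X u) := by
      rw [neg_sub, sub_eq_sub_iff_add_eq_add, add_comm y, hadd, add_comm]
    have h5 := quadCost_exchange x y (X u) (Y u)
    rw [hy, inner_neg_right, real_inner_self_eq_norm_sq] at h5
    have h6 : ‖(minty (x, y)).2 - (minty (X u, Y u)).2‖ ^ 2 / 2 = ‖x - X u‖ ^ 2 := by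
      rw [norm_minty_sub_snd_sq]
      simp only
      rw [show x - y - (X u - Y u) = (x - X u) - (y - Y u) by abel, hy, sub_neg_eq_add,
        ← two_smul ℝ, norm_smul, mul_pow]
      norm_num
      ring
    rw [h6, dualityGap, hf, hg, ← EReal.coe_add, ← EReal.coe_sub, EReal.toENNReal_of_ne_top
      (EReal.coe_ne_top _), EReal.toReal_coe]
    exact ENNReal.ofReal_le_ofReal (by linarith [hrs u])

/-! ### Extension of Lipschitz maps between Euclidean spaces -/

/-- The set `M` of pairs `(u, v)` is the graph of a map with Lipschitz constant one. -/
def IsNonexpansive (M : Set (Rd d × Rd d)) : Prop :=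
  ∀ p ∈ M, ∀ q ∈ M, ‖p.2 - q.2‖ ≤ ‖p.1 - q.1‖

/-- Nonexpansiveness reads `h p + h q ≤ 2(⟪p.2, q.2⟫ - ⟪p.1, q.1⟫)` with `h p = ‖p.2‖² - ‖p.1‖²`. On
lifted points `(p, h p)` this is affine in each argument separately, so it passes to the convex hull
one variable at a time; then take the diagonal. -/
lemma le_inner_of_mem_convexHull {S : Set (Rd d × Rd d)} (hS : IsNonexpansive S)
    {z : (Rd d × Rd d) × ℝ}
    (hz : z ∈ convexHull ℝ ((fun p : Rd d × Rd d => (p, ‖p.2‖ ^ 2 - ‖p.1‖ ^ 2)) '' S)) :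
    z.2 ≤ ‖z.1.2‖ ^ 2 := by
  set P := (fun p : Rd d × Rd d => (p, ‖p.2‖ ^ 2 - ‖p.1‖ ^ 2)) '' S
  have hlin : ∀ w : (Rd d × Rd d) × ℝ, Convex ℝ {z : (Rd d × Rd d) × ℝ |
      w.2 + z.2 ≤ 2 * (inner ℝ w.1.2 z.1.2 - inner ℝ w.1.1 z.1.1)} := fun w => by
    intro a ha b hb s t hs ht hst
    simp only [Set.mem_ofPred_eq, Prod.snd_add, Prod.fst_add, Prod.smul_fst, Prod.smul_snd,
      inner_add_right, inner_smul_right, smul_eq_mul] at ha hb ⊢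
    have hw : w.2 = s * w.2 + t * w.2 := by rw [← add_mul, hst, one_mul]
    nlinarith [mul_le_mul_of_nonneg_left ha hs, mul_le_mul_of_nonneg_left hb ht]
  have h1 : ∀ w ∈ P, ∀ z ∈ convexHull ℝ P,
      w.2 + z.2 ≤ 2 * (inner ℝ w.1.2 z.1.2 - inner ℝ w.1.1 z.1.1) := fun w hw => by
    refine convexHull_min (s := P) (fun y hy => ?_) (hlin w)
    obtain ⟨p, hp, rfl⟩ := hw
    obtain ⟨q, hq, rfl⟩ := hy
    have := pow_le_pow_left₀ (norm_nonneg _) (hS p hp q hq) 2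
    rw [norm_sub_sq_real, norm_sub_sq_real] at this
    change ‖p.2‖ ^ 2 - ‖p.1‖ ^ 2 + (‖q.2‖ ^ 2 - ‖q.1‖ ^ 2) ≤
      2 * (inner ℝ p.2 q.2 - inner ℝ p.1 q.1)
    linarith
  have h2 : ∀ w ∈ convexHull ℝ P, ∀ z ∈ convexHull ℝ P,
      w.2 + z.2 ≤ 2 * (inner ℝ w.1.2 z.1.2 - inner ℝ w.1.1 z.1.1) := fun w hw z hz => by
    have := convexHull_min (s := P) (fun y hy => ?_) (hlin z) hw
    · simp only [Set.mem_ofPred_eq] at this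
      rw [real_inner_comm, real_inner_comm z.1.1 w.1.1]
      linarith
    · have := h1 y hy z hz
      simp only [Set.mem_ofPred_eq]
      rw [real_inner_comm, real_inner_comm y.1.1 z.1.1]
      linarith
  have := h2 z hz z hz
  rw [real_inner_self_eq_norm_sq, real_inner_self_eq_norm_sq] at this
  nlinarith [sq_nonneg ‖z.1.1‖]

/-- Minimax: if every `v` fails at some point of `S`, Sion's theorem yields one `z` in the hull of
the lifted points that defeats all `v` at once, but `v = z.1.2` contradicts
`le_inner_of_mem_convexHull`. -/
lemma IsNonexpansive.exists_of_finite {S : Set (Rd d × Rd d)} (hS : IsNonexpansive S)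
    (hfin : S.Finite) : ∃ v : Rd d, ∀ p ∈ S, ‖v - p.2‖ ≤ ‖p.1‖ := by
  rcases S.eq_empty_or_nonempty with rfl | hne
  · exact ⟨0, by simp⟩
  by_contra! hcon
  set e : Rd d × Rd d → (Rd d × Rd d) × ℝ := fun p => (p, ‖p.2‖ ^ 2 - ‖p.1‖ ^ 2)
  set X : Set (Rd d) := convexHull ℝ (Prod.snd '' S)
  -- On lifted points `f v (e p) = ‖v - p.2‖² - ‖p.1‖²`; the lift makes `f` affine in its second
  -- argument.
  set f : Rd d → (Rd d × Rd d) × ℝ → ℝ := fun v z => ‖v‖ ^ 2 + (z.2 - 2 * inner ℝ v z.1.2)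
  have hfx : ∀ x, ConcaveOn ℝ (convexHull ℝ (e '' S)) (f x) := fun x =>
    ⟨convex_convexHull _ _, fun a _ b _ s t _ _ hst => le_of_eq (by
      simp only [f, Prod.snd_add, Prod.fst_add, Prod.smul_fst, Prod.smul_snd,
        inner_add_right, inner_smul_right, smul_eq_mul]
      linear_combination (‖x‖ ^ 2) * hst)⟩
  have hfy : ∀ y, ConvexOn ℝ X fun x => f x y := fun y => by
    refine ConvexOn.add ((convexOn_norm (convex_convexHull _ _)).pow
      (fun _ _ => norm_nonneg _) 2) ⟨convex_convexHull _ _, fun a _ b _ s t _ _ hst => le_of_eq ?_⟩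
    simp only [inner_add_left, inner_smul_left, smul_eq_mul, RCLike.conj_to_real]
    linear_combination (-y.2) * hst
  obtain ⟨z, hz, hpos⟩ := Sion.exists_lt_iInf_of_lt_iInf_of_finite (X := X)
    (Y := convexHull ℝ (e '' S)) (f := f) (t := 0) (hne.image _).convexHull
    ((hfin.image _).isCompact_convexHull ℝ)
    (fun y _ => (Continuous.lowerSemicontinuous (by fun_prop)).lowerSemicontinuousOn _)
    (fun y _ => (hfy y).quasiconvexOn)
    (convex_convexHull _ _)
    (fun x _ => (Continuous.upperSemicontinuous (by fun_prop)).upperSemicontinuousOn _)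
    (fun x _ => (hfx x).quasiconcaveOn)
    (convex_convexHull _ _) (s := e '' S) (hfin.image _) (subset_convexHull _ _)
    (fun x _ => by
      obtain ⟨p, hp, hlt⟩ := hcon x
      refine ⟨e p, ⟨p, hp, rfl⟩, ?_⟩
      have := pow_lt_pow_left₀ hlt (norm_nonneg _) two_ne_zero
      rw [norm_sub_sq_real] at this
      simp only [f, e]
      linarith)
  have hzX : z.1.2 ∈ X := by
    have := Set.mem_image_of_mem ((LinearMap.snd ℝ (Rd d) (Rd d)).comp
      (LinearMap.fst ℝ (Rd d × Rd d) ℝ)) hz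
    rw [LinearMap.image_convexHull, Set.image_image] at this
    exact this
  have h1 := hpos _ hzX
  have h2 := le_inner_of_mem_convexHull hS hz
  simp only [f, real_inner_self_eq_norm_sq] at h1
  linarith

/-- Finite intersection property of closed balls, after translating `u` to the origin; `p₀` joins
every finite family to confine the point to one compact ball. -/
lemma IsNonexpansive.exists_insert {M : Set (Rd d × Rd d)} (hM : IsNonexpansive M) (u : Rd d) :
    ∃ v : Rd d, ∀ p ∈ M, ‖v - p.2‖ ≤ ‖u - p.1‖ := by
  rcases M.eq_empty_or_nonempty with rfl | ⟨p₀, hp₀⟩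
  · exact ⟨0, by simp⟩
  have := (isCompact_closedBall p₀.2 ‖u - p₀.1‖).inter_iInter_nonempty
    (fun p : M => Metric.closedBall p.1.2 ‖u - p.1.1‖) (fun _ => Metric.isClosed_closedBall)
    fun F => by
      set S : Set (Rd d × Rd d) := (fun p : Rd d × Rd d => (p.1 - u, p.2)) ''
        (insert p₀ ((Subtype.val : M → _) '' (F : Set M)))
      have hsub : insert p₀ ((Subtype.val : M → _) '' (F : Set M)) ⊆ M :=
        Set.insert_subset hp₀ (Subtype.coe_image_subset _ _)
      have hS : IsNonexpansive S := by
        rintro _ ⟨p, hp, rfl⟩ _ ⟨q, hq, rfl⟩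
        simpa using hM p (hsub hp) q (hsub hq)
      obtain ⟨v, hv⟩ := hS.exists_of_finite (((F.finite_toSet.image _).insert p₀).image _)
      have hv' : ∀ p ∈ insert p₀ ((Subtype.val : M → _) '' (F : Set M)),
          v ∈ Metric.closedBall p.2 ‖u - p.1‖ := fun p hp => by
        rw [mem_closedBall_iff_norm, norm_sub_rev u]
        exact hv _ ⟨p, hp, rfl⟩
      refine ⟨v, hv' p₀ (Set.mem_insert _ _), Set.mem_iInter₂.2 fun p hp => hv' p ?_⟩
      exact Set.mem_insert_of_mem _ ⟨p, hp, rfl⟩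
  obtain ⟨v, -, hv⟩ := this
  exact ⟨v, fun p hp => mem_closedBall_iff_norm.1 (Set.mem_iInter.1 hv ⟨p, hp⟩)⟩

/-- Kirszbraun's theorem, for subsets of the graph. -/
theorem IsNonexpansive.exists_lipschitz {M : Set (Rd d × Rd d)} (hM : IsNonexpansive M) :
    ∃ T : Rd d → Rd d, LipschitzWith 1 T ∧ ∀ p ∈ M, T p.1 = p.2 := by
  obtain ⟨N, hMN, hN⟩ := zorn_subset_nonempty {M : Set (Rd d × Rd d) | IsNonexpansive M}
    (fun c hc hchain _ => ⟨⋃₀ c, fun p ⟨A, hA, hp⟩ q ⟨B, hB, hq⟩ => by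
      rcases hchain.total hA hB with h | h
      · exact hc hB p (h hp) q hq
      · exact hc hA p hp q (h hq), fun _ => Set.subset_sUnion_of_mem⟩) M hM
  have hN' : IsNonexpansive N := hN.prop
  have hT : ∀ u, ∃ v, (u, v) ∈ N := fun u => by
    obtain ⟨v, hv⟩ := hN'.exists_insert u
    have hins : IsNonexpansive (insert (u, v) N) := by
      rintro p (rfl | hp) q (rfl | hq)
      · simp
      · exact hv q hq
      · rw [norm_sub_rev, norm_sub_rev p.1]; exact hv p hp
      · exact hN' p hp q hq
    exact ⟨v, hN.le_of_ge hins (Set.subset_insert _ _) (Set.mem_insert _ _)⟩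
  choose T hT using hT
  refine ⟨T, LipschitzWith.of_dist_le_mul fun u w => ?_, fun p hp => ?_⟩
  · simpa [dist_eq_norm] using hN' _ (hT u) _ (hT w)
  · simpa [sub_eq_zero] using hN' _ (hT p.1) _ (hMN hp)

/-! ### Optimal plans are monotone -/

lemma lintegral_quadCost_ne_top {μ₀ μ₁ : Measure (Rd d)} (hμ₀ : IsP2 μ₀) (hμ₁ : IsP2 μ₁)
    {γ : Measure (Rd d × Rd d)} (hγ : IsPlan μ₀ μ₁ γ) :
    ∫⁻ p, ENNReal.ofReal (quadCost p.1 p.2) ∂γ ≠ ⊤ := by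
  have key : ∀ {μ : Measure (Rd d)}, IsP2 μ → ∫⁻ x, ENNReal.ofReal (‖x‖ ^ 2) ∂μ ≠ ⊤ := fun h => by
    have := (h.2.integrable_norm_pow two_ne_zero).lintegral_lt_top
    exact this.ne
  have h0 : ∫⁻ p, ENNReal.ofReal (‖p.1‖ ^ 2) ∂γ ≠ ⊤ := by
    rw [← lintegral_map (f := fun x : Rd d => ENNReal.ofReal (‖x‖ ^ 2)) (by fun_prop) measurable_fst,
      ← Measure.fst]
    exact hγ.1.symm ▸ key hμ₀
  have h1 : ∫⁻ p, ENNReal.ofReal (‖p.2‖ ^ 2) ∂γ ≠ ⊤ := by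
    rw [← lintegral_map (f := fun x : Rd d => ENNReal.ofReal (‖x‖ ^ 2)) (by fun_prop) measurable_snd,
      ← Measure.snd]
    exact hγ.2.symm ▸ key hμ₁
  refine ne_top_of_le_ne_top (ENNReal.add_ne_top.2 ⟨h0, h1⟩) ?_
  rw [← lintegral_add_left (by fun_prop)]
  refine lintegral_mono fun p => ?_
  rw [← ENNReal.ofReal_add (by positivity) (by positivity)]
  refine ENNReal.ofReal_le_ofReal ?_
  unfold quadCost
  have := norm_sub_le p.1 p.2
  nlinarith [sq_nonneg (‖p.1‖ - ‖p.2‖), norm_nonneg (p.1 - p.2)]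

/-- The pairs of points of `ℝ^d × ℝ^d` whose targets are better exchanged. -/
def exchangeSet (d : ℕ) : Set ((Rd d × Rd d) × (Rd d × Rd d)) :=
  {q | quadCost q.1.1 q.2.2 + quadCost q.2.1 q.1.2 < quadCost q.1.1 q.1.2 + quadCost q.2.1 q.2.2}

lemma isOpen_exchangeSet : IsOpen (exchangeSet d) := by
  unfold exchangeSet quadCost
  exact isOpen_lt (by fun_prop) (by fun_prop)

lemma swap_mem_exchangeSet (q : (Rd d × Rd d) × (Rd d × Rd d)) :
    q.swap ∈ exchangeSet d ↔ q ∈ exchangeSet d := by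
  simp only [exchangeSet, Set.mem_ofPred_eq, Prod.fst_swap, Prod.snd_swap]
  rw [add_comm, add_comm (quadCost q.2.1 q.2.2)]

lemma setLIntegral_exchangeSet_swap (γ : Measure (Rd d × Rd d)) [SFinite γ]
    {f : (Rd d × Rd d) × (Rd d × Rd d) → ℝ≥0∞} (hf : Measurable f) :
    ∫⁻ q in exchangeSet d, f q.swap ∂γ.prod γ = ∫⁻ q in exchangeSet d, f q ∂γ.prod γ := by
  rw [← lintegral_indicator isOpen_exchangeSet.measurableSet,
    ← lintegral_indicator isOpen_exchangeSet.measurableSet,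
    ← Measure.measurePreserving_swap.lintegral_comp
      (hf.indicator isOpen_exchangeSet.measurableSet)]
  refine lintegral_congr fun q => ?_
  by_cases hq : q ∈ exchangeSet d
  · rw [Set.indicator_of_mem hq, Set.indicator_of_mem ((swap_mem_exchangeSet q).2 hq)]
  · rw [Set.indicator_of_notMem hq, Set.indicator_of_notMem (mt (swap_mem_exchangeSet q).1 hq)]

open Classical in
/-- Exchange the targets of two points, independently chosen, when this lowers the cost. -/
def exchange (q : (Rd d × Rd d) × (Rd d × Rd d)) : Rd d × Rd d :=
  (q.1.1, if q ∈ exchangeSet d then q.2.2 else q.1.2)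

lemma measurable_exchange : Measurable (exchange (d := d)) :=
  (by fun_prop : Measurable fun q : (Rd d × Rd d) × (Rd d × Rd d) => q.1.1).prodMk
    (Measurable.ite isOpen_exchangeSet.measurableSet (by fun_prop) (by fun_prop))

lemma lintegral_exchange (γ : Measure (Rd d × Rd d)) [SFinite γ]
    {f : Rd d × Rd d → ℝ≥0∞} :
    ∫⁻ q, f (exchange q) ∂γ.prod γ = ∫⁻ q in exchangeSet d, f (q.1.1, q.2.2) ∂γ.prod γ +
      ∫⁻ q in (exchangeSet d)ᶜ, f q.1 ∂γ.prod γ := by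
  have hA := isOpen_exchangeSet (d := d).measurableSet
  rw [← lintegral_add_compl _ hA]
  congr 1
  · refine setLIntegral_congr_fun hA fun q hq => ?_
    simp only [exchange, if_pos hq]
  · refine setLIntegral_congr_fun hA.compl fun q hq => ?_
    simp only [exchange, if_neg hq]

/-- Sources are untouched. For targets, swap-invariance of `γ ⊗ γ` and of `exchangeSet` makes
`q.2.2` and `q.1.2` equally distributed on that set. -/
lemma isPlan_map_exchange {μ₀ μ₁ : Measure (Rd d)} {γ : Measure (Rd d × Rd d)}
    [IsProbabilityMeasure γ] (hγ : IsPlan μ₀ μ₁ γ) :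
    IsPlan μ₀ μ₁ ((γ.prod γ).map exchange) := by
  constructor
  · rw [Measure.fst, Measure.map_map measurable_fst measurable_exchange, ← hγ.1, Measure.fst,
      show (Prod.fst ∘ exchange : (Rd d × Rd d) × (Rd d × Rd d) → Rd d) = Prod.fst ∘ Prod.fst
        from rfl, ← Measure.map_map measurable_fst measurable_fst]
    congr 1
    exact Measure.fst_prod
  · rw [← hγ.2]
    refine Measure.ext_of_lintegral _ fun f hf => ?_
    rw [Measure.snd, Measure.snd, lintegral_map hf measurable_snd,
      lintegral_map (by fun_prop) measurable_exchange, lintegral_map hf measurable_snd,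
      lintegral_exchange γ (f := fun p => f p.2)]
    have h1 := setLIntegral_exchangeSet_swap γ (f := fun q => f q.1.2) (by fun_prop)
    simp only [Prod.fst_swap] at h1
    rw [h1, lintegral_add_compl _ isOpen_exchangeSet.measurableSet]
    exact measurePreserving_fst.lintegral_comp (f := fun p : Rd d × Rd d => f p.2) (by fun_prop)

theorem IsOptimalPlan.measure_exchangeSet {μ₀ μ₁ : Measure (Rd d)} (hμ₀ : IsP2 μ₀)
    (hμ₁ : IsP2 μ₁) {γ : Measure (Rd d × Rd d)} [IsProbabilityMeasure γ]
    (hγ : IsOptimalPlan μ₀ μ₁ γ) : (γ.prod γ) (exchangeSet d) = 0 := by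
  have hA := isOpen_exchangeSet (d := d).measurableSet
  set C : Rd d × Rd d → ℝ≥0∞ := fun p => ENNReal.ofReal (quadCost p.1 p.2) with hC
  have hCm : Measurable C := (ENNReal.continuous_ofReal.comp continuous_quadCost).measurable
  have hfin : ∫⁻ p, C p ∂γ ≠ ⊤ := lintegral_quadCost_ne_top hμ₀ hμ₁ hγ.1
  have hopt := hγ.2 _ (isPlan_map_exchange hγ.1)
  rw [lintegral_map hCm measurable_exchange, lintegral_exchange γ (f := C)] at hopt
  have hfst : ∫⁻ q, C q.1 ∂γ.prod γ = ∫⁻ p, C p ∂γ :=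
    measurePreserving_fst.lintegral_comp hCm
  have hsplit := lintegral_add_compl (μ := γ.prod γ) (fun q => C q.1) hA
  rw [hfst] at hsplit
  have hfin1 : ∫⁻ q in exchangeSet d, C q.1 ∂γ.prod γ ≠ ⊤ :=
    ne_top_of_le_ne_top hfin (hsplit ▸ le_self_add)
  have hfin2 : ∫⁻ q in (exchangeSet d)ᶜ, C q.1 ∂γ.prod γ ≠ ⊤ :=
    ne_top_of_le_ne_top hfin (hsplit ▸ le_add_self)
  have hle : ∫⁻ q in exchangeSet d, C q.1 ∂γ.prod γ ≤
      ∫⁻ q in exchangeSet d, C (q.1.1, q.2.2) ∂γ.prod γ := by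
    rw [← hsplit] at hopt
    exact (ENNReal.add_le_add_iff_right hfin2).1 hopt
  have hs1 := setLIntegral_exchangeSet_swap γ (f := fun q => C q.1) (by fun_prop)
  have hs2 := setLIntegral_exchangeSet_swap γ (f := fun q => C (q.1.1, q.2.2)) (by fun_prop)
  simp only [Prod.fst_swap, Prod.snd_swap] at hs1 hs2
  -- The strict pointwise inequality concerns the total cost of both points, so the optimality bound
  -- is symmetrized by the swap.
  have hsum : ∫⁻ q in exchangeSet d, (C q.1 + C q.2) ∂γ.prod γ ≤
      ∫⁻ q in exchangeSet d, (C (q.1.1, q.2.2) + C (q.2.1, q.1.2)) ∂γ.prod γ := by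
    rw [lintegral_add_left (by fun_prop), lintegral_add_left (by fun_prop), hs1, hs2]
    exact add_le_add hle hle
  have hpt : ∀ q ∈ exchangeSet d, C (q.1.1, q.2.2) + C (q.2.1, q.1.2) < C q.1 + C q.2 := by
    intro q hq
    simp only [hC]
    rw [← ENNReal.ofReal_add (quadCost_nonneg _ _) (quadCost_nonneg _ _),
      ← ENNReal.ofReal_add (quadCost_nonneg _ _) (quadCost_nonneg _ _)]
    exact (ENNReal.ofReal_lt_ofReal_iff_of_nonneg
      (add_nonneg (quadCost_nonneg _ _) (quadCost_nonneg _ _))).2 hq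
  by_contra hne
  have hfinS : ∫⁻ q in exchangeSet d, (C q.1 + C q.2) ∂γ.prod γ ≠ ⊤ := by
    rw [lintegral_add_left (by fun_prop), hs1]
    exact ENNReal.add_ne_top.2 ⟨hfin1, hfin1⟩
  refine absurd hsum (not_le.2 (setLIntegral_strict_mono hA hne (by fun_prop) ?_
    (ae_of_all _ fun q hq => hpt q hq)))
  exact ne_top_of_le_ne_top hfinS (setLIntegral_mono' hA fun q hq => (hpt q hq).le)

/-- `exchangeSet` is open, so a violating pair of support points would give it positive `γ ⊗ γ`
mass. -/
theorem IsOptimalPlan.monotone_support {μ₀ μ₁ : Measure (Rd d)} (hμ₀ : IsP2 μ₀)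
    (hμ₁ : IsP2 μ₁) {γ : Measure (Rd d × Rd d)} [IsProbabilityMeasure γ]
    (hγ : IsOptimalPlan μ₀ μ₁ γ) {p q : Rd d × Rd d} (hp : p ∈ γ.support) (hq : q ∈ γ.support) :
    0 ≤ inner ℝ (p.1 - q.1) (p.2 - q.2) := by
  rw [← quadCost_exchange]
  by_contra hcon
  have hmem : (p, q) ∈ exchangeSet d := by
    simp only [exchangeSet, Set.mem_ofPred_eq]; linarith
  obtain ⟨U, hU, V, hV, hUV⟩ := mem_nhds_prod_iff.1 (isOpen_exchangeSet.mem_nhds hmem)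
  have h0 := measure_mono_null hUV (hγ.measure_exchangeSet hμ₀ hμ₁)
  rw [Measure.prod_prod, mul_eq_zero] at h0
  rcases h0 with h0 | h0
  · exact ((Measure.mem_support_iff_forall p).1 hp U hU).ne' h0
  · exact h0.not_gt ((Measure.mem_support_iff_forall q).1 hq V hV)

/-- The transport distance to an optimal plan dominates the mean squared distance to a Lipschitz
graph in Minty's coordinates. -/
theorem IsOptimalPlan.exists_lipschitz_le_W2sq {μ₀ μ₁ : Measure (Rd d)} (hμ₀ : IsP2 μ₀)
    (hμ₁ : IsP2 μ₁) {γ₀ : Measure (Rd d × Rd d)} (hγ₀ : IsOptimalPlan μ₀ μ₁ γ₀)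
    (γ : Measure (Rd d × Rd d)) :
    ∃ T : Rd d → Rd d, LipschitzWith 1 T ∧
      ∫⁻ p, ENNReal.ofReal (‖(minty p).2 - T (minty p).1‖ ^ 2 / 2) ∂γ ≤ W2sq γ γ₀ := by
  have hprob : IsProbabilityMeasure γ₀ := by
    have := hμ₀.1
    rw [← hγ₀.1.1, Measure.fst] at this
    exact Measure.isProbabilityMeasure_of_map Prod.fst
  have hM : IsNonexpansive (minty '' γ₀.support) := by
    rintro _ ⟨p, hp, rfl⟩ _ ⟨q, hq, rfl⟩
    exact norm_minty_sub_le (hγ₀.monotone_support hμ₀ hμ₁ hp hq)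
  obtain ⟨T, hT, hTM⟩ := hM.exists_lipschitz
  refine ⟨T, hT, le_iInf₂ fun π hπ => ?_⟩
  have hmeas : Measurable fun p : Rd d × Rd d =>
      ENNReal.ofReal (‖(minty p).2 - T (minty p).1‖ ^ 2 / 2) := by
    have := hT.continuous.measurable
    unfold minty
    fun_prop
  rw [← hπ.1, Measure.fst, lintegral_map hmeas measurable_fst]
  have hae : ∀ᵐ q ∂π, q.2 ∈ γ₀.support := by
    have : ∀ᵐ z ∂π.snd, z ∈ γ₀.support := by rw [hπ.2]; exact Measure.support_mem_ae
    exact ae_of_ae_map measurable_snd.aemeasurable this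
  refine lintegral_mono_ae ?_
  filter_upwards [hae] with q hq
  refine ENNReal.ofReal_le_ofReal ?_
  have h1 : T (minty q.2).1 = (minty q.2).2 := hTM _ ⟨q.2, hq, rfl⟩
  -- Vertical distance to the graph is at most vertical plus horizontal distance to a graph point;
  -- `(a + b)²/2 ≤ a² + b²` then explains the factor `1/2`.
  have h2 : ‖(minty q.1).2 - T (minty q.1).1‖ ≤
      ‖(minty q.1).2 - (minty q.2).2‖ + ‖(minty q.1).1 - (minty q.2).1‖ := by
    rw [← h1]
    refine (norm_sub_le_norm_sub_add_norm_sub _ (T (minty q.2).1) _).trans ?_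
    gcongr
    have := hT.dist_le_mul (minty q.2).1 (minty q.1).1
    rw [dist_eq_norm, dist_eq_norm, norm_sub_rev (minty q.2).1] at this
    simpa using this
  have h3 : ‖(minty q.1).2 - (minty q.2).2‖ ^ 2 + ‖(minty q.1).1 - (minty q.2).1‖ ^ 2 =
      sqDist2d q.1 q.2 := by
    rw [norm_minty_sub_fst_sq, norm_minty_sub_snd_sq, sqDist2d,
      show q.1.1 + q.1.2 - (q.2.1 + q.2.2) = (q.1.1 - q.2.1) + (q.1.2 - q.2.2) by abel,
      show q.1.1 - q.1.2 - (q.2.1 - q.2.2) = (q.1.1 - q.2.1) - (q.1.2 - q.2.2) by abel,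
      norm_add_sq_real, norm_sub_sq_real]
    ring
  rw [← h3]
  nlinarith [pow_le_pow_left₀ (norm_nonneg _) h2 2,
    sq_nonneg (‖(minty q.1).2 - (minty q.2).2‖ - ‖(minty q.1).1 - (minty q.2).1‖)]

/-! ### Minty's coordinates preserve Lebesgue measure -/

lemma minty_minty (p : Rd d × Rd d) : minty (minty p) = p := by
  have h : (Real.sqrt 2)⁻¹ * (Real.sqrt 2)⁻¹ = (2 : ℝ)⁻¹ := by
    rw [← mul_inv, Real.mul_self_sqrt (by norm_num)]
  ext1
  · rw [minty_fst, minty_fst, minty_snd, ← smul_add, smul_smul, h,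
      show p.1 + p.2 + (p.1 - p.2) = (2 : ℝ) • p.1 by rw [two_smul]; abel, smul_smul]
    norm_num
  · rw [minty_snd, minty_fst, minty_snd, ← smul_sub, smul_smul, h,
      show p.1 + p.2 - (p.1 - p.2) = (2 : ℝ) • p.2 by rw [two_smul]; abel, smul_smul]
    norm_num

lemma continuous_minty : Continuous (minty (d := d)) := by
  unfold minty; fun_prop

lemma minty_add (p q : Rd d × Rd d) : minty (p + q) = minty p + minty q := by
  ext1
  · simp only [minty_fst, Prod.fst_add, Prod.snd_add, ← smul_add]
    congr 1; abel
  · simp only [minty_snd, Prod.fst_add, Prod.snd_add, ← smul_add]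
    congr 1; abel

lemma minty_smul (c : ℝ) (p : Rd d × Rd d) : minty (c • p) = c • minty p := by
  ext1
  · simp only [minty_fst, Prod.smul_fst, Prod.smul_snd, ← smul_add]
    rw [smul_comm]
  · simp only [minty_snd, Prod.smul_fst, Prod.smul_snd, ← smul_sub]
    rw [smul_comm]

/-- Minty's change of coordinates as an isometry of the Euclidean product. -/
def mintyIsometry (d : ℕ) : WithLp 2 (Rd d × Rd d) ≃ₗᵢ[ℝ] WithLp 2 (Rd d × Rd d) where
  toFun z := WithLp.toLp 2 (minty z.ofLp)
  invFun z := WithLp.toLp 2 (minty z.ofLp)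
  left_inv z := by simp [minty_minty]
  right_inv z := by simp [minty_minty]
  map_add' z w := congrArg (WithLp.toLp 2) (minty_add z.ofLp w.ofLp)
  map_smul' c z := congrArg (WithLp.toLp 2) (minty_smul c z.ofLp)
  norm_map' z := by
    refine (sq_eq_sq₀ (norm_nonneg _) (norm_nonneg _)).1 ?_
    change ‖WithLp.toLp 2 (minty z.ofLp)‖ ^ 2 = ‖z‖ ^ 2
    rw [WithLp.prod_norm_sq_eq_of_L2, WithLp.prod_norm_sq_eq_of_L2]
    change ‖(minty z.ofLp).1‖ ^ 2 + ‖(minty z.ofLp).2‖ ^ 2 = ‖z.ofLp.1‖ ^ 2 + ‖z.ofLp.2‖ ^ 2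
    rw [minty_fst, minty_snd, norm_inv_sqrt_two_smul_sq, norm_inv_sqrt_two_smul_sq,
      norm_add_sq_real, norm_sub_sq_real]
    ring

/-- The map is isometric for the `ℓ²` norm, not the product's maximum norm, hence the detour through
`WithLp 2`. -/
lemma measurePreserving_minty :
    MeasurePreserving (minty (d := d)) volume volume :=
  ((WithLp.volume_preserving_ofLp (Rd d) (Rd d)).comp
    (mintyIsometry d).measurePreserving).comp (WithLp.volume_preserving_toLp (Rd d) (Rd d))

/-- A density that is a product in coordinates sheared by `T`. -/
lemma lintegral_minty_shear {f g : Rd d → ℝ≥0∞} (hf : Measurable f) (hg : Measurable g)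
    {T : Rd d → Rd d} (hT : Measurable T) :
    ∫⁻ p, f (minty p).1 * g ((minty p).2 - T (minty p).1) =
      (∫⁻ u, f u) * ∫⁻ v, g v := by
  rw [measurePreserving_minty.lintegral_comp
      (f := fun q : Rd d × Rd d => f q.1 * g (q.2 - T q.1)) (by fun_prop),
    Measure.volume_eq_prod, lintegral_prod _ (by fun_prop), ← lintegral_mul_const _ hf]
  refine lintegral_congr fun u => ?_
  simp only
  rw [lintegral_const_mul _ (by fun_prop), lintegral_sub_right_eq_self]

/-! ### Gaussian densities -/

/-- The logarithm of the centered Gaussian density with covariance `s • id`. -/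
def logGauss (s : ℝ) (w : Rd d) : ℝ :=
  -((d : ℝ) / 2) * Real.log (2 * Real.pi * s) - ‖w‖ ^ 2 / (2 * s)

lemma continuous_logGauss (s : ℝ) : Continuous (logGauss (d := d) s) := by
  unfold logGauss; fun_prop

lemma lintegral_exp_logGauss {s : ℝ} (hs : 0 < s) :
    ∫⁻ w : Rd d, ENNReal.ofReal (Real.exp (logGauss s w)) = 1 := by
  have hps : 0 < 2 * Real.pi * s := by positivity
  have h1 := GaussianFourier.integral_rexp_neg_mul_sq_norm (V := Rd d) (b := 1 / (2 * s))
    (by positivity)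
  rw [finrank_euclideanSpace_fin, show Real.pi / (1 / (2 * s)) = 2 * Real.pi * s by
    field_simp] at h1
  have h2 : ∀ w : Rd d, Real.exp (logGauss s w) =
      ((2 * Real.pi * s) ^ ((d : ℝ) / 2))⁻¹ * Real.exp (-(1 / (2 * s)) * ‖w‖ ^ 2) := fun w => by
    rw [Real.rpow_def_of_pos hps, ← Real.exp_neg, ← Real.exp_add, logGauss]
    congr 1; ring
  have h3 : ∫ w : Rd d, Real.exp (logGauss s w) = 1 := by
    simp_rw [h2]
    rw [integral_const_mul, h1, inv_mul_cancel₀ (by positivity)]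
  rw [← ofReal_integral_eq_lintegral_ofReal _ (ae_of_all _ fun _ => (Real.exp_pos _).le), h3,
    ENNReal.ofReal_one]
  -- A non-integrable function would have Bochner integral `0`.
  exact Integrable.of_integral_ne_zero (by rw [h3]; exact one_ne_zero)

lemma integrable_logGauss_comp {X : Type*} [MeasurableSpace X] {γ : Measure X}
    [IsProbabilityMeasure γ] {W : X → Rd d} (hW : Measurable W) {s : ℝ} (hs : 0 < s) {b : ℝ}
    (hb : 0 ≤ b) (h : ∫⁻ x, ENNReal.ofReal (‖W x‖ ^ 2) ∂γ ≤ ENNReal.ofReal b) :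
    Integrable (fun x => logGauss s (W x)) γ ∧
      -((d : ℝ) / 2) * Real.log (2 * Real.pi * s) - b / (2 * s) ≤ ∫ x, logGauss s (W x) ∂γ := by
  have hi : Integrable (fun x => ‖W x‖ ^ 2) γ := by
    refine ⟨by fun_prop, ?_⟩
    rw [hasFiniteIntegral_iff_ofReal (ae_of_all _ fun _ => by positivity)]
    exact h.trans_lt ENNReal.ofReal_lt_top
  have hle : ∫ x, ‖W x‖ ^ 2 ∂γ ≤ b := by
    rw [integral_eq_lintegral_of_nonneg_ae (ae_of_all _ fun _ => by positivity) hi.1]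
    exact ENNReal.toReal_le_of_le_ofReal hb h
  refine ⟨(integrable_const _).sub (hi.div_const _), ?_⟩
  simp only [logGauss]
  rw [integral_sub (integrable_const _) (hi.div_const _), integral_const, integral_div]
  simp only [probReal_univ, one_smul]
  gcongr

/-! ### The Gibbs inequality -/

section Gibbs

variable {X : Type*} [MeasurableSpace X] {γ ν : Measure X}

lemma measurable_log_rnDeriv : Measurable fun x => Real.log (γ.rnDeriv ν x).toReal :=
  (Measure.measurable_rnDeriv γ ν).ennreal_toReal.log

/-- `log t ≤ t - 1` at `t = k = Q / (dγ/dν)`, whose `γ`-integral is at most `∫ Q dν`. The pointwise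
form remains usable before `log Q` is known to be integrable. -/
lemma exists_integrable_log_density_le [IsProbabilityMeasure γ] [SigmaFinite ν] (hγ : γ ≪ ν)
    {Q : X → ℝ} (hQ : Measurable Q) (hpos : ∀ᵐ x ∂γ, 0 < Q x)
    (hint : ∫⁻ x, ENNReal.ofReal (Q x) ∂ν ≤ 1) :
    ∃ k : X → ℝ, Integrable k γ ∧ ∫ x, k x ∂γ ≤ 1 ∧
      ∀ᵐ x ∂γ, Real.log (Q x) + 1 - k x ≤ Real.log (γ.rnDeriv ν x).toReal := by
  have hρ := Measure.measurable_rnDeriv γ ν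
  have hm : Measurable fun x => ENNReal.ofReal (Q x) / γ.rnDeriv ν x :=
    hQ.ennreal_ofReal.div hρ
  have hle : ∫⁻ x, ENNReal.ofReal (Q x) / γ.rnDeriv ν x ∂γ ≤ 1 := by
    rw [← lintegral_rnDeriv_mul hγ hm.aemeasurable]
    exact (lintegral_mono fun x => ENNReal.mul_div_le).trans hint
  have hne := ne_top_of_le_ne_top ENNReal.one_ne_top hle
  refine ⟨fun x => (ENNReal.ofReal (Q x) / γ.rnDeriv ν x).toReal,
    integrable_toReal_of_lintegral_ne_top hm.aemeasurable hne, ?_, ?_⟩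
  · rw [integral_toReal hm.aemeasurable (ae_lt_top hm hne)]
    exact ENNReal.toReal_le_of_le_ofReal zero_le_one (by simpa using hle)
  · filter_upwards [hpos, Measure.rnDeriv_pos hγ, hγ.ae_le (Measure.rnDeriv_ne_top γ ν)]
      with x hx hx0 hxt
    have hr : 0 < (γ.rnDeriv ν x).toReal := ENNReal.toReal_pos hx0.ne' hxt
    rw [ENNReal.toReal_div, ENNReal.toReal_ofReal hx.le]
    have := Real.log_le_sub_one_of_pos (div_pos hx hr)
    rw [Real.log_div hx.ne' hr.ne'] at this
    linarith

lemma integrable_log_rnDeriv (hp : entropyPos γ ν ≠ ⊤) (hn : entropyNeg γ ν ≠ ⊤) :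
    Integrable (fun x => Real.log (γ.rnDeriv ν x).toReal) γ := by
  refine ⟨measurable_log_rnDeriv.aestronglyMeasurable, ?_⟩
  refine lt_of_le_of_lt ?_ (ENNReal.add_lt_top.2 ⟨hp.lt_top, hn.lt_top⟩)
  rw [entropyPos, entropyNeg, ← lintegral_add_left measurable_log_rnDeriv.ennreal_ofReal]
  refine lintegral_mono fun x => ?_
  rw [Real.enorm_eq_ofReal_abs]
  rcases abs_cases (Real.log (γ.rnDeriv ν x).toReal) with ⟨h, -⟩ | ⟨h, -⟩ <;> rw [h]
  · exact le_self_add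
  · exact le_add_self

lemma relEntropy_eq_integral (hγ : γ ≪ ν)
    (h : Integrable (fun x => Real.log (γ.rnDeriv ν x).toReal) γ) :
    relEntropy γ ν = ((∫ x, Real.log (γ.rnDeriv ν x).toReal ∂γ : ℝ) : EReal) := by
  have hp : entropyPos γ ν ≠ ⊤ := h.lintegral_lt_top.ne
  have hn : entropyNeg γ ν ≠ ⊤ := h.neg.lintegral_lt_top.ne
  rw [relEntropy, if_pos ⟨hγ, hp⟩, integral_eq_lintegral_pos_part_sub_lintegral_neg_part h,
    EReal.coe_sub]
  change _ = ((entropyPos γ ν).toReal : EReal) - ((entropyNeg γ ν).toReal : EReal)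
  rw [EReal.coe_ennreal_toReal hp, EReal.coe_ennreal_toReal hn]

lemma relEntropy_eq_top_of_entropyPos (h : entropyPos γ ν = ⊤) : relEntropy γ ν = ⊤ := by
  rw [relEntropy, if_neg fun hc => hc.2 h]

/-- The Gibbs inequality: the cross entropy with a probability density bounds the entropy. -/
theorem integral_log_le_relEntropy [IsProbabilityMeasure γ] [SigmaFinite ν] (hγ : γ ≪ ν)
    {Q : X → ℝ} (hQ : Measurable Q) (hpos : ∀ᵐ x ∂γ, 0 < Q x)
    (hint : ∫⁻ x, ENNReal.ofReal (Q x) ∂ν ≤ 1) (hlog : Integrable (fun x => Real.log (Q x)) γ) :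
    ((∫ x, Real.log (Q x) ∂γ : ℝ) : EReal) ≤ relEntropy γ ν := by
  obtain ⟨k, hk, hk1, hle⟩ := exists_integrable_log_density_le hγ hQ hpos hint
  by_cases hp : entropyPos γ ν = ⊤
  · rw [relEntropy_eq_top_of_entropyPos hp]; exact le_top
  have hi : Integrable (fun x => Real.log (Q x) + 1 - k x) γ :=
    (hlog.add (integrable_const _)).sub hk
  have hn : entropyNeg γ ν ≠ ⊤ := by
    refine ne_top_of_le_ne_top hi.neg.lintegral_lt_top.ne (lintegral_mono_ae ?_)
    filter_upwards [hle] with x hx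
    exact ENNReal.ofReal_le_ofReal (neg_le_neg hx)
  have hL := integrable_log_rnDeriv hp hn
  rw [relEntropy_eq_integral hγ hL, EReal.coe_le_coe_iff]
  have h1 := integral_mono_ae hi hL hle
  rw [integral_sub (f := fun x => Real.log (Q x) + 1) (hlog.add (integrable_const _)) hk,
    integral_add hlog (integrable_const _), integral_const] at h1
  simp only [probReal_univ, one_smul] at h1
  linarith

end Gibbs

/-! ### Entropy of measures near a Lipschitz graph -/

lemma mintyMarginal_eq_map (γ : Measure (Rd d × Rd d)) :
    mintyMarginal γ = γ.map fun p => (minty p).1 := by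
  rw [mintyMarginal, Measure.fst, Measure.map_map measurable_fst continuous_minty.measurable]
  rfl

lemma measurable_minty_fst : Measurable fun p : Rd d × Rd d => (minty p).1 :=
  continuous_minty.measurable.fst

lemma measurable_minty_snd : Measurable fun p : Rd d × Rd d => (minty p).2 :=
  continuous_minty.measurable.snd

lemma mintyMarginal_absolutelyContinuous {γ : Measure (Rd d × Rd d)} (hγ : γ ≪ volume) :
    mintyMarginal γ ≪ volume := by
  rw [mintyMarginal_eq_map]
  exact (hγ.map measurable_minty_fst).trans
    ((Measure.quasiMeasurePreserving_fst (μ := (volume : Measure (Rd d)))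
      (ν := (volume : Measure (Rd d)))).comp
        measurePreserving_minty.quasiMeasurePreserving).absolutelyContinuous

section MainEstimates

variable {γ : Measure (Rd d × Rd d)} [IsProbabilityMeasure γ] {T : Rd d → Rd d} {M : ℝ≥0∞}

lemma nontrivial_euclidean (hd : 0 < d) : Nontrivial (Rd d) := by
  have : Nonempty (Fin d) := ⟨⟨0, hd⟩⟩
  infer_instance

/-- Graphs in Minty's coordinates are Lebesgue null. -/
lemma volume_minty_graph (hd : 0 < d) (hT : Continuous T) :
    volume {p : Rd d × Rd d | (minty p).2 = T (minty p).1} = 0 := by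
  have := nontrivial_euclidean hd
  have hm : MeasurableSet {q : Rd d × Rd d | q.2 = T q.1} :=
    (isClosed_eq continuous_snd (hT.comp continuous_fst)).measurableSet
  have h := measurePreserving_minty.measure_preimage hm.nullMeasurableSet
  refine h.trans ?_
  rw [Measure.volume_eq_prod, Measure.measure_prod_null hm]
  refine ae_of_all _ fun u => ?_
  change volume {v : Rd d | v = T u} = 0
  simp

/-- `M = 0` would concentrate `γ` on a Lebesgue null graph. -/
lemma ne_zero_of_lintegral_graph_le (hd : 0 < d) (hγ : γ ≪ volume) (hT : Continuous T)
    (hM : ∫⁻ p, ENNReal.ofReal (‖(minty p).2 - T (minty p).1‖ ^ 2 / 2) ∂γ ≤ M) : M ≠ 0 := by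
  rintro rfl
  have hm1 := measurable_minty_fst (d := d)
  have hm2 := measurable_minty_snd (d := d)
  have hTm := hT.measurable
  rw [nonpos_iff_eq_zero, lintegral_eq_zero_iff (by fun_prop)] at hM
  have h1 : ∀ᵐ p ∂γ, (minty p).2 = T (minty p).1 := by
    filter_upwards [hM] with p hp
    rw [Pi.zero_apply, ENNReal.ofReal_eq_zero] at hp
    have : ‖(minty p).2 - T (minty p).1‖ ^ 2 = 0 := le_antisymm (by linarith) (by positivity)
    rwa [sq_eq_zero_iff, norm_eq_zero, sub_eq_zero] at this
  have h2 : ∀ᵐ p ∂γ, ¬ (minty p).2 = T (minty p).1 := by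
    have h3 : ∀ᵐ p : Rd d × Rd d, ¬ (minty p).2 = T (minty p).1 := by
      rw [ae_iff]
      simpa using volume_minty_graph hd hT
    exact hγ.ae_le h3
  obtain ⟨p, hp, hp'⟩ := (h1.and h2).exists
  exact hp' hp

/-- `X + Y` has an absolutely continuous law, so it is not almost surely constant. This rules out `0
* ⊤ = 0` in the entropy power bound. -/
lemma sigmaSum_ne_zero (hd : 0 < d) (hγ : γ ≪ volume) : sigmaSum γ ≠ 0 := by
  have := nontrivial_euclidean hd
  intro h
  set m : Rd d := ∫ q, (q.1 + q.2) ∂γ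
  rw [sigmaSum, ENNReal.rpow_eq_zero_iff_of_pos (by norm_num),
    lintegral_eq_zero_iff (by fun_prop)] at h
  have h1 : ∀ᵐ p ∂γ, (minty p).1 = (Real.sqrt 2)⁻¹ • m := by
    filter_upwards [h] with p hp
    rw [Pi.zero_apply, pow_eq_zero_iff two_ne_zero, enorm_eq_zero, sub_eq_zero] at hp
    rw [minty_fst, hp]
  have h2 : ∀ᵐ p ∂γ, (minty p).1 ≠ (Real.sqrt 2)⁻¹ • m := by
    have h3 : ∀ᵐ u ∂mintyMarginal γ, u ≠ (Real.sqrt 2)⁻¹ • m :=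
      (mintyMarginal_absolutelyContinuous hγ).ae_le (Measure.ae_ne volume _)
    rw [mintyMarginal_eq_map] at h3
    exact ae_of_ae_map measurable_minty_fst.aemeasurable h3
  obtain ⟨p, hp, hp'⟩ := (h1.and h2).exists
  exact hp' hp

lemma lintegral_ofReal_norm_sq_le {X : Type*} [MeasurableSpace X] {μ : Measure X} {W : X → Rd d}
    {m : ℝ}
    (h : ∫⁻ x, ENNReal.ofReal (‖W x‖ ^ 2 / 2) ∂μ ≤ ENNReal.ofReal m) :
    ∫⁻ x, ENNReal.ofReal (‖W x‖ ^ 2) ∂μ ≤ ENNReal.ofReal (2 * m) := by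
  rw [ENNReal.ofReal_mul (by norm_num)]
  refine le_trans (le_of_eq ?_) (mul_le_mul_right h _)
  rw [← lintegral_const_mul' _ _ ENNReal.ofReal_ne_top]
  refine lintegral_congr fun x => ?_
  rw [← ENNReal.ofReal_mul (by norm_num)]
  congr 1; ring

/-- `s = 2m/d` maximizes `-(d/2) log(2πs) - 2m/(2s)`, the Gaussian cross-entropy bound for second
moment `2m`. -/
lemma gaussian_constant (hd : 0 < d) {m : ℝ} (hm : 0 < m) :
    -((d : ℝ) / 2) * Real.log (2 * Real.pi * (2 * m / d)) - 2 * m / (2 * (2 * m / d)) =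
      -((d : ℝ) / 2) * Real.log m + constC d := by
  have hd' : (0 : ℝ) < d := by exact_mod_cast hd
  rw [constC, show 2 * Real.pi * (2 * m / d) = m * (4 * Real.pi / d) by ring,
    show 4 * Real.pi * Real.exp 1 / d = 4 * Real.pi / d * Real.exp 1 by ring,
    Real.log_mul hm.ne' (by positivity), Real.log_mul (by positivity) (Real.exp_pos _).ne',
    Real.log_exp]
  field_simp
  ring

/-- The entropy of a measure is bounded below in terms of its first marginal in Minty's coordinates
and of the mean squared distance to a graph. -/
theorem diffEntropy_ge_of_graph (hd : 0 < d) (hγ : γ ≪ volume) (hT : Continuous T)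
    (hM : ∫⁻ p, ENNReal.ofReal (‖(minty p).2 - T (minty p).1‖ ^ 2 / 2) ∂γ ≤ M) :
    ((-((d : ℝ) / 2) : ℝ) : EReal) * ENNReal.log M + diffEntropy (mintyMarginal γ)
      + (constC d : EReal) ≤ diffEntropy γ := by
  have hd' : (0 : ℝ) < d := by exact_mod_cast hd
  have hM0 := ne_zero_of_lintegral_graph_le hd hγ hT hM
  -- Here the left side is `⊥`, even if the marginal entropy is `⊤`, because `⊥ + ⊤ = ⊥` in `EReal`.
  rcases eq_or_ne M ⊤ with rfl | hMt
  · rw [ENNReal.log_top, EReal.coe_mul_top_of_neg (by linarith)]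
    simp
  obtain ⟨m, hm, rfl⟩ : ∃ m : ℝ, 0 < m ∧ M = ENNReal.ofReal m :=
    ⟨M.toReal, ENNReal.toReal_pos hM0 hMt, (ENNReal.ofReal_toReal hMt).symm⟩
  by_cases hp : entropyPos γ volume = ⊤
  · rw [diffEntropy, diffEntropy, relEntropy_eq_top_of_entropyPos hp]; exact le_top
  have hac := mintyMarginal_absolutelyContinuous hγ
  have hm1 := measurable_minty_fst (d := d)
  have hm2 := measurable_minty_snd (d := d)
  have hTm := hT.measurable
  have hprob : IsProbabilityMeasure (mintyMarginal γ) := by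
    rw [mintyMarginal_eq_map]; exact Measure.isProbabilityMeasure_map hm1.aemeasurable
  set s : ℝ := 2 * m / d with hs
  have hs0 : 0 < s := by positivity
  set ρ : Rd d → ℝ≥0∞ := (mintyMarginal γ).rnDeriv volume with hρ
  have hρm : Measurable ρ := Measure.measurable_rnDeriv _ _
  obtain ⟨hgi, hgle⟩ := integrable_logGauss_comp (γ := γ)
    (W := fun p => (minty p).2 - T (minty p).1) (by fun_prop) hs0 (by positivity)
    (lintegral_ofReal_norm_sq_le hM)
  rw [gaussian_constant hd hm] at hgle
  have hgc := (continuous_logGauss (d := d) s).measurable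
  set Q : Rd d × Rd d → ℝ := fun p => (ρ (minty p).1).toReal *
    Real.exp (logGauss s ((minty p).2 - T (minty p).1)) with hQ
  have hQm : Measurable Q := by fun_prop
  have hρpos : ∀ᵐ p ∂γ, 0 < (ρ (minty p).1).toReal := by
    have : ∀ᵐ u ∂mintyMarginal γ, 0 < (ρ u).toReal := by
      filter_upwards [Measure.rnDeriv_pos hac,
        hac.ae_le (Measure.rnDeriv_ne_top (mintyMarginal γ) volume)] with u h1 h2
      exact ENNReal.toReal_pos h1.ne' h2
    rw [mintyMarginal_eq_map] at this
    exact ae_of_ae_map hm1.aemeasurable this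
  have hQpos : ∀ᵐ p ∂γ, 0 < Q p := by
    filter_upwards [hρpos] with p hp
    exact mul_pos hp (Real.exp_pos _)
  have hlogQ : ∀ᵐ p ∂γ, Real.log (Q p) = Real.log (ρ (minty p).1).toReal +
      logGauss s ((minty p).2 - T (minty p).1) := by
    filter_upwards [hρpos] with p hp
    simp only [hQ]
    rw [Real.log_mul hp.ne' (Real.exp_pos _).ne', Real.log_exp]
  have hQint : ∫⁻ p, ENNReal.ofReal (Q p) ≤ 1 := by
    simp only [hQ, ENNReal.ofReal_mul ENNReal.toReal_nonneg]
    rw [lintegral_minty_shear (f := fun u => ENNReal.ofReal (ρ u).toReal)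
      (g := fun w => ENNReal.ofReal (Real.exp (logGauss s w))) (by fun_prop) (by fun_prop) hTm,
      lintegral_exp_logGauss hs0, mul_one]
    refine (lintegral_mono fun u => ENNReal.ofReal_toReal_le).trans ?_
    exact Measure.lintegral_rnDeriv_le.trans_eq measure_univ
  obtain ⟨k, hk, -, hkle⟩ := exists_integrable_log_density_le hγ hQm hQpos hQint
  -- The pointwise Gibbs bound controls `log ρ` by the log-density of `γ` plus an integrable term,
  -- so the marginal entropy cannot be `⊤` here.
  have hp' : entropyPos (mintyMarginal γ) volume ≠ ⊤ := by
    have hrest : Integrable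
        (fun p => k p - 1 - logGauss s ((minty p).2 - T (minty p).1)) γ :=
      (hk.sub (integrable_const _)).sub hgi
    refine ne_top_of_le_ne_top (ENNReal.add_ne_top.2 ⟨hp, hrest.lintegral_lt_top.ne⟩) ?_
    rw [entropyPos, entropyPos, ← lintegral_add_left measurable_log_rnDeriv.ennreal_ofReal, ← hρ,
      show (∫⁻ u, ENNReal.ofReal (Real.log (ρ u).toReal) ∂mintyMarginal γ) =
        ∫⁻ p, ENNReal.ofReal (Real.log (ρ (minty p).1).toReal) ∂γ by
          rw [mintyMarginal_eq_map, lintegral_map (by fun_prop) hm1]]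
    refine lintegral_mono_ae ?_
    filter_upwards [hkle, hlogQ] with p h1 h2
    rw [h2] at h1
    refine le_trans (ENNReal.ofReal_le_ofReal ?_) ENNReal.ofReal_add_le
    linarith
  by_cases hn' : entropyNeg (mintyMarginal γ) volume = ⊤
  · rw [diffEntropy, relEntropy, if_pos ⟨hac, hp'⟩, hn', EReal.coe_ennreal_top, EReal.sub_top]
    simp
  have hL := integrable_log_rnDeriv hp' hn'
  rw [diffEntropy, relEntropy_eq_integral hac hL, ← hρ]
  rw [← hρ] at hL
  have hLi : Integrable (fun p => Real.log (ρ (minty p).1).toReal) γ := by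
    rw [mintyMarginal_eq_map] at hL
    exact hL.comp_measurable hm1
  have hLeq : ∫ u, Real.log (ρ u).toReal ∂mintyMarginal γ =
      ∫ p, Real.log (ρ (minty p).1).toReal ∂γ := by
    rw [mintyMarginal_eq_map, integral_map hm1.aemeasurable
      (by fun_prop : Measurable fun u => Real.log (ρ u).toReal).aestronglyMeasurable]
  have hmain := integral_log_le_relEntropy hγ hQm hQpos hQint
    ((hLi.add hgi).congr (hlogQ.mono fun p hp => hp.symm))
  rw [integral_congr_ae hlogQ, integral_add hLi hgi, ← hLeq] at hmain
  refine le_trans ?_ hmain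
  rw [ENNReal.log_ofReal_of_pos hm, ← EReal.coe_mul, ← EReal.coe_add, ← EReal.coe_add,
    EReal.coe_le_coe_iff]
  linarith

lemma gaussian_product_constant (hd : 0 < d) {m τ : ℝ} (hm : 0 < m) (hτ : 0 < τ) :
    1 / (2 * Real.pi * Real.exp 1) * Real.exp (-(2 / ((2 * d : ℕ) : ℝ)) *
      ((-((d : ℝ) / 2) * Real.log (τ ^ 2 / 4) + constC d) +
        (-((d : ℝ) / 2) * Real.log m + constC d))) = τ / d * m ^ (1 / 2 : ℝ) := by
  have hd' : (0 : ℝ) < d := by exact_mod_cast hd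
  have h1 : -(2 / ((2 * d : ℕ) : ℝ)) *
      ((-((d : ℝ) / 2) * Real.log (τ ^ 2 / 4) + constC d) +
        (-((d : ℝ) / 2) * Real.log m + constC d)) =
      Real.log (τ / 2) + Real.log (4 * Real.pi * Real.exp 1 / d) + Real.log m * (1 / 2) := by
    rw [constC, show τ ^ 2 / 4 = (τ / 2) ^ 2 by ring, Real.log_pow]
    push_cast
    field_simp
    ring
  rw [h1, Real.exp_add, Real.exp_add, Real.exp_log (by positivity), Real.exp_log (by positivity),
    ← Real.rpow_def_of_pos hm]
  field_simp
  ring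

/-- The entropy power of a measure is bounded in terms of the deviation of its first marginal in
Minty's coordinates and of the mean squared distance to a graph. -/
theorem entropyPower_le_of_graph (hd : 0 < d) (hγ : γ ≪ volume) (hT : Continuous T)
    (hM : ∫⁻ p, ENNReal.ofReal (‖(minty p).2 - T (minty p).1‖ ^ 2 / 2) ∂γ ≤ M) :
    entropyPower (2 * d) γ ≤ sigmaSum γ / (d : ℝ≥0∞) * M ^ (1 / 2 : ℝ) := by
  have hd' : (0 : ℝ) < d := by exact_mod_cast hd
  have hM0 := ne_zero_of_lintegral_graph_le hd hγ hT hM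
  have hσ0 := sigmaSum_ne_zero hd hγ
  have hσd : sigmaSum γ / (d : ℝ≥0∞) ≠ 0 :=
    ENNReal.div_ne_zero.2 ⟨hσ0, ENNReal.natCast_ne_top d⟩
  rcases eq_or_ne M ⊤ with rfl | hMt
  · rw [ENNReal.top_rpow_of_pos (by norm_num), ENNReal.mul_top hσd]; exact le_top
  rcases eq_or_ne (sigmaSum γ) ⊤ with hσt | hσt
  · rw [hσt, ENNReal.top_div_of_ne_top (ENNReal.natCast_ne_top d), ENNReal.top_mul]
    · exact le_top
    · simp [hM0, hMt]
  obtain ⟨m, hm, rfl⟩ : ∃ m : ℝ, 0 < m ∧ M = ENNReal.ofReal m :=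
    ⟨M.toReal, ENNReal.toReal_pos hM0 hMt, (ENNReal.ofReal_toReal hMt).symm⟩
  obtain ⟨τ, hτ, hτσ⟩ : ∃ τ : ℝ, 0 < τ ∧ sigmaSum γ = ENNReal.ofReal τ :=
    ⟨_, ENNReal.toReal_pos hσ0 hσt, (ENNReal.ofReal_toReal hσt).symm⟩
  set c : Rd d := ∫ q, (q.1 + q.2) ∂γ with hc
  have hm1 := measurable_minty_fst (d := d)
  have hm2 := measurable_minty_snd (d := d)
  have hTm := hT.measurable
  -- The first Minty coordinate has variance `τ²/2`; halving it matches the normalization of the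
  -- graph bound.
  have hvar : ∫⁻ p, ENNReal.ofReal (‖(minty p).1 - (Real.sqrt 2)⁻¹ • c‖ ^ 2 / 2) ∂γ ≤
      ENNReal.ofReal (τ ^ 2 / 4) := by
    have h1 : ∫⁻ p, ‖(p.1 + p.2) - c‖ₑ ^ 2 ∂γ = ENNReal.ofReal (τ ^ 2) := by
      rw [ENNReal.ofReal_pow hτ.le, ← hτσ, sigmaSum, ← ENNReal.rpow_natCast, ← ENNReal.rpow_mul]
      norm_num [hc]
    rw [show τ ^ 2 / 4 = 1 / 4 * τ ^ 2 by ring, ENNReal.ofReal_mul (by norm_num), ← h1,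
      ← lintegral_const_mul' _ _ ENNReal.ofReal_ne_top]
    refine lintegral_mono fun p => le_of_eq ?_
    rw [minty_fst, ← smul_sub, norm_inv_sqrt_two_smul_sq, ← ofReal_norm,
      ← ENNReal.ofReal_pow (norm_nonneg _), ← ENNReal.ofReal_mul (by norm_num)]
    congr 1; ring
  have hτ4 : 0 < τ ^ 2 / 4 := by positivity
  set s : ℝ := 2 * m / d with hs
  have hs0 : 0 < s := by positivity
  set t : ℝ := 2 * (τ ^ 2 / 4) / d with ht
  have ht0 : 0 < t := by positivity
  obtain ⟨hgi, hgle⟩ := integrable_logGauss_comp (γ := γ)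
    (W := fun p => (minty p).2 - T (minty p).1) (by fun_prop) hs0 (by positivity)
    (lintegral_ofReal_norm_sq_le hM)
  rw [gaussian_constant hd hm] at hgle
  obtain ⟨hfi, hfle⟩ := integrable_logGauss_comp (γ := γ)
    (W := fun p => (minty p).1 - (Real.sqrt 2)⁻¹ • c) (by fun_prop) ht0 (by positivity)
    (lintegral_ofReal_norm_sq_le hvar)
  rw [gaussian_constant hd hτ4] at hfle
  have hgs := (continuous_logGauss (d := d) s).measurable
  have hgt := (continuous_logGauss (d := d) t).measurable
  set Q : Rd d × Rd d → ℝ := fun p => Real.exp (logGauss t ((minty p).1 - (Real.sqrt 2)⁻¹ • c)) *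
    Real.exp (logGauss s ((minty p).2 - T (minty p).1)) with hQ
  have hlogQ : ∀ p, Real.log (Q p) = logGauss t ((minty p).1 - (Real.sqrt 2)⁻¹ • c) +
      logGauss s ((minty p).2 - T (minty p).1) := fun p => by
    simp only [hQ]
    rw [← Real.exp_add, Real.log_exp]
  have hQint : ∫⁻ p, ENNReal.ofReal (Q p) ≤ 1 := by
    simp only [hQ, ENNReal.ofReal_mul (Real.exp_pos _).le]
    rw [lintegral_minty_shear
      (f := fun u => ENNReal.ofReal (Real.exp (logGauss t (u - (Real.sqrt 2)⁻¹ • c))))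
      (g := fun w => ENNReal.ofReal (Real.exp (logGauss s w))) (by fun_prop) (by fun_prop) hTm,
      lintegral_exp_logGauss hs0, mul_one,
      lintegral_sub_right_eq_self (fun u => ENNReal.ofReal (Real.exp (logGauss t u))),
      lintegral_exp_logGauss ht0]
  have hmain := integral_log_le_relEntropy hγ (Q := Q) (by fun_prop)
    (ae_of_all _ fun p => mul_pos (Real.exp_pos _) (Real.exp_pos _)) hQint
    ((hfi.add hgi).congr (ae_of_all _ fun p => (hlogQ p).symm))
  rw [integral_congr_ae (ae_of_all _ hlogQ), integral_add hfi hgi] at hmain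
  have hH := (EReal.coe_le_coe_iff.2 (add_le_add hfle hgle)).trans hmain
  have hneg : ((-(2 / ((2 * d : ℕ) : ℝ)) : ℝ) : EReal) ≤ 0 := by
    rw [← EReal.coe_zero, EReal.coe_le_coe_iff, neg_nonpos]; positivity
  rw [entropyPower, diffEntropy, mul_comm (((-(2 / ((2 * d : ℕ) : ℝ)) : ℝ) : EReal))]
  refine (mul_le_mul_right (EReal.exp_monotone
    (EReal.mul_le_mul_of_nonpos_right hH hneg)) _).trans (le_of_eq ?_)
  rw [mul_comm _ (((-(2 / ((2 * d : ℕ) : ℝ)) : ℝ) : EReal)), ← EReal.coe_mul, EReal.exp_coe,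
    ← ENNReal.ofReal_mul (by positivity), gaussian_product_constant hd hm hτ, hτσ,
    ENNReal.ofReal_rpow_of_pos hm, ← ENNReal.ofReal_natCast d, ← ENNReal.ofReal_div_of_pos hd',
    ← ENNReal.ofReal_mul (by positivity)]

end MainEstimates

end QuadraticOT

end

theorem proposition3p4 {d : ℕ} (hd : 0 < d)
    (μ₀ μ₁ : MeasureTheory.Measure (QuadraticOT.Rd d))
    (hμ₀ : QuadraticOT.IsP2 μ₀) (hμ₁ : QuadraticOT.IsP2 μ₁)
    (φ ψ : QuadraticOT.Rd d → EReal)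
    (hφψ : QuadraticOT.IsKantorovichPair μ₀ μ₁ φ ψ)
    (γ₀ : MeasureTheory.Measure (QuadraticOT.Rd d × QuadraticOT.Rd d))
    (hγ₀ : QuadraticOT.IsOptimalPlan μ₀ μ₁ γ₀)
    (γ : MeasureTheory.Measure (QuadraticOT.Rd d × QuadraticOT.Rd d))
    [MeasureTheory.IsProbabilityMeasure γ]
    (hγ : γ ≪ MeasureTheory.volume) :
    ((-((d : ℝ) / 2) : ℝ) : EReal) * ENNReal.log (QuadraticOT.gapIntegral φ ψ γ)
        + QuadraticOT.diffEntropy (QuadraticOT.mintyMarginal γ)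
        + (QuadraticOT.constC d : EReal) ≤ QuadraticOT.diffEntropy γ ∧
    ((-((d : ℝ) / 2) : ℝ) : EReal) * ENNReal.log (QuadraticOT.W2sq γ γ₀)
        + QuadraticOT.diffEntropy (QuadraticOT.mintyMarginal γ)
        + (QuadraticOT.constC d : EReal) ≤ QuadraticOT.diffEntropy γ ∧
    QuadraticOT.entropyPower (2 * d) γ
      ≤ QuadraticOT.sigmaSum γ / (d : ENNReal) * QuadraticOT.gapIntegral φ ψ γ ^ (1 / 2 : ℝ) ∧
    QuadraticOT.entropyPower (2 * d) γ
      ≤ QuadraticOT.sigmaSum γ / (d : ENNReal) * QuadraticOT.W2 γ γ₀ := by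
  obtain ⟨x, hx⟩ := have := hμ₀.1; hφψ.left_ne_bot.exists
  obtain ⟨y, hy⟩ := have := hμ₁.1; hφψ.right_ne_bot.exists
  obtain ⟨T, hT, hgap⟩ := QuadraticOT.exists_lipschitz_le_dualityGap hφψ.left_eq hφψ.right_eq
    hφψ.left_ne_top hφψ.right_ne_top ⟨x, hx⟩ ⟨y, hy⟩
  have hE : ∫⁻ p, ENNReal.ofReal
      (‖(QuadraticOT.minty p).2 - T (QuadraticOT.minty p).1‖ ^ 2 / 2) ∂γ ≤
      QuadraticOT.gapIntegral φ ψ γ := MeasureTheory.lintegral_mono hgap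
  obtain ⟨S, hS, hW⟩ := hγ₀.exists_lipschitz_le_W2sq hμ₀ hμ₁ γ
  exact ⟨QuadraticOT.diffEntropy_ge_of_graph hd hγ hT.continuous hE,
    QuadraticOT.diffEntropy_ge_of_graph hd hγ hS.continuous hW,
    QuadraticOT.entropyPower_le_of_graph hd hγ hT.continuous hE,
    QuadraticOT.entropyPower_le_of_graph hd hγ hS.continuous hW⟩
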